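/- Let $\mathbb{F}_q$ be a finite field of characteristic $p$, let $F=\mathbb{F}_q(T)$, and let $K$ and $L$ be finite separable extensions of $F$. Let $\mathcal{O}_K$ be the integral closure of $\mathbb{F}_q[T]$ in $K$. For a nonzero prime $\mathfrak{P}$ of $\mathcal{O}_K$ lying over the prime generated by the monic irreducible $f\in\mathbb{F}_q[T]$, with inertia degree $d=[\mathcal{O}_K/\mathfrak{P}:\mathbb{F}_q[T]/(f)]$, put $N(\mathfrak{P})=f^{d}$, and extend $N$ multiplicatively to all nonzero ideals of $\mathcal{O}_K$. For monic $f$ let $B_K(f)$ be the number of nonzero ideals of $\mathcal{O}_K$ with norm $f$. For a nonzero prime $\mathfrak{p}$ of $\mathbb{F}_q[T]$ let $f_K(\mathfrak{p})=(f_1\le\dots\le f_r)$ be the list of inertia degrees of the primes of $\mathcal{O}_K$ above $\mathfrak{p}$. Call $K$ and $L$ arithmetically equivalent over $F$ with no exceptions if $f_K(\mathfrak{p})=f_L(\mathfrak{p})$ for every nonzero prime $\mathfrak{p}$ of $\mathbb{F}_q[T]$. Let $F_\infty$ be the completion of $F$ at the place at infinity and $\mathbb{C}_F$ the completion of an algebraic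 closure of $F_\infty$, with absolute value $\|\cdot\|$ and ring of integers $\mathcal{O}=\{x\in\mathbb{C}_F:\|x\|\le 1\}$. Let $S_\infty=\mathbb{C}_F^*\times\mathbb{Z}_p$, with inverses $-(x,y)=(x^{-1},-y)$. For $f\in\mathbb{F}_q[T]$ monic and $s=(x,y)\in S_\infty$ put $f^s=x^{\deg f}\langle f\rangle^y$, where $\langle f\rangle=T^{-\deg f}f=1+m_f$ with $\|m_f\|<1$ and $\langle f\rangle^y=\prod_{i\ge 0}(1+m_f^{p^i})^{a_i}$ for the $p$-adic expansion $y=\sum_{i\ge 0}a_ip^i$ with $0\le a_i<p$. Let $W$ be the ring of ($p$-typical) Witt vectors of $\mathbb{C}_F$, with the weak topology, for which the sets $\{(x_n)_{n\ge 0}: x_0,\dots,x_m\in I\}$, with $I$ an open ideal of $\mathcal{O}$ and $m\in\mathbb{N}$, form a fundamental system of neighbourhoods of $0$, and let $\chi:\mathbb{C}_F\to W$ be the Teichmüller map. The lifted Goss zeta function of $K/F$ is $$\zeta^{[0]}_{K/F}(s)=\sum_{0\ne\mathfrak{I}\subset\mathcal{O}_K}\chi\bigl(N(\mathfrak{I})^{-s}\bigr),\qquad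 s=(x,y)\in S_\infty,\ \|x\|>1 .$$ Then: (i) the series defining $\zeta^{[0]}_{K/F}(s)$ and $\zeta^{[0]}_{L/F}(s)$ converge (unconditionally) in $W$ for every $s=(x,y)\in S_\infty$ with $\|x\|>1$; (ii) $K$ and $L$ are arithmetically equivalent over $F$ with no exceptions if and only if $\zeta^{[0]}_{K/F}(s)=\zeta^{[0]}_{L/F}(s)$ for all $s=(x,y)\in S_\infty$ with $\|x\|>1$; (iii) $\zeta^{[0]}_{K/F}(s)=\zeta^{[0]}_{L/F}(s)$ for all $s=(x,y)\in S_\infty$ with $\|x\|>1$ if and only if $B_K(f)=B_L(f)$ for every monic $f\in\mathbb{F}_q[T]$. -/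

import Mathlib

open Polynomial
open scoped NNReal WithZero

noncomputable section

namespace GossZeta

section Analytic

variable (Fq : Type*) [Field Fq]

open scoped Classical in
/-- `F_∞`, the completion of `F = 𝔽_q(T)` at the place at infinity. -/
abbrev FInfty : Type _ := RatFunc.CompletionAtInfty Fq

open scoped Classical in
theorem FInfty.valued_X :
    Valued.v (algebraMap (RatFunc Fq) (FInfty Fq) RatFunc.X) = WithZero.exp (1 : ℤ) := by
  rw [← RatFunc.inftyValuation.X (F := Fq)]
  exact @Valued.extensionValuation_apply_coe (RatFunc Fq) _ _ _ (RatFunc.inftyValued Fq) RatFunc.X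

variable [Finite Fq]

theorem one_lt_card_nnreal : (1 : ℝ≥0) < (Nat.card Fq : ℝ≥0) := by
  exact_mod_cast Finite.one_lt_card

open MonoidWithZeroHom.ValueGroup₀ in
/-- The absolute value at infinity is normalised by `‖T‖ = q`. -/
instance FInfty.rankOne : Valuation.RankOne (Valued.v (R := FInfty Fq) (Γ₀ := ℤᵐ⁰)) where
  hom' := (WithZeroMulInt.toNNReal (one_lt_card_nnreal Fq).ne_zero).comp embedding
  strictMono' :=
    (WithZeroMulInt.toNNReal_strictMono (one_lt_card_nnreal Fq)).comp embedding_strictMono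
  exists_val_nontrivial := by
    refine ⟨algebraMap (RatFunc Fq) (FInfty Fq) RatFunc.X, ?_⟩
    rw [FInfty.valued_X]
    exact ⟨WithZero.exp_ne_zero, by decide⟩

instance FInfty.nontriviallyNormedField : NontriviallyNormedField (FInfty Fq) :=
  Valued.toNontriviallyNormedField (L := FInfty Fq) (Γ₀ := ℤᵐ⁰)

instance FInfty.isUltrametricDist : IsUltrametricDist (FInfty Fq) :=
  Valued.instIsUltrametricDist (FInfty Fq) ℤᵐ⁰

open scoped Classical in
instance FInfty.completeSpace : CompleteSpace (FInfty Fq) :=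
  letI := (RatFunc.inftyValued Fq).toUniformSpace
  inferInstanceAs (CompleteSpace (UniformSpace.Completion (RatFunc Fq)))

/-- A fixed algebraic closure of `F_∞`, with the unique extension of the absolute value. -/
abbrev FInftyAlg : Type _ := AlgebraicClosure (FInfty Fq)

instance FInftyAlg.normedField : NormedField (FInftyAlg Fq) :=
  spectralNorm.normedField (FInfty Fq) (FInftyAlg Fq)

/-- `ℂ_F`, the completion of the algebraic closure of `F_∞`. -/
abbrev CInfty : Type _ := UniformSpace.Completion (FInftyAlg Fq)

instance FInftyAlg.isUltrametricDist : IsUltrametricDist (FInftyAlg Fq) :=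
  IsUltrametricDist.isUltrametricDist_of_forall_norm_add_le_max_norm
    (isNonarchimedean_spectralNorm (K := FInfty Fq) (L := FInftyAlg Fq))

instance FInftyAlg.normedAlgebra : NormedAlgebra (FInfty Fq) (FInftyAlg Fq) :=
  spectralNorm.normedAlgebra _ _

instance CInfty.isUltrametricDist : IsUltrametricDist (CInfty Fq) :=
  IsUltrametricDist.of_normedAlgebra (FInfty Fq)

/-- The embedding `𝔽_q(T) → ℂ_F`. -/
def toCInfty : RatFunc Fq →+* CInfty Fq :=
  ((algebraMap (FInftyAlg Fq) (CInfty Fq)).comp (algebraMap (FInfty Fq) (FInftyAlg Fq))).comp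
    (algebraMap (RatFunc Fq) (FInfty Fq))

/-- The ring of integers `{x ∈ ℂ_F : ‖x‖ ≤ 1}`. -/
abbrev CInftyInt : Subring (CInfty Fq) := (NormedField.valuation (K := CInfty Fq)).integer

variable (p : ℕ) [Fact p.Prime]

/-- The ring `W` of Witt vectors of `ℂ_F`. -/
abbrev W : Type _ := WittVector p (CInfty Fq)

/-- `V_{I,m}`: the Witt vectors whose components `x_0, …, x_m` all lie in the ideal `I`. -/
def basicNhd (I : Ideal (CInftyInt Fq)) (m : ℕ) : Set (W Fq p) :=
  {x | ∀ n ≤ m, ∃ a ∈ I, (a : CInfty Fq) = x.coeff n}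

/-- The weak topology on `W`: the sets `V_{I,m}`, for `I` an open ideal of the ring of integers
of `ℂ_F` and `m ∈ ℕ`, are a fundamental system of neighbourhoods of `0`. -/
instance weakTopology : TopologicalSpace (W Fq p) where
  IsOpen U := ∀ x ∈ U, ∃ I : Ideal (CInftyInt Fq), IsOpen (I : Set (CInftyInt Fq)) ∧
    ∃ m : ℕ, ∀ y : W Fq p, y - x ∈ basicNhd Fq p I m → y ∈ U
  isOpen_univ _ _ := ⟨⊤, isOpen_univ, 0, fun _ _ => trivial⟩
  isOpen_inter U V hU hV x hx := by
    obtain ⟨I, hI, m, h⟩ := hU x hx.1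
    obtain ⟨J, hJ, k, h'⟩ := hV x hx.2
    refine ⟨I ⊓ J, hI.inter hJ, max m k, fun y hy => ⟨h y fun n hn => ?_, h' y fun n hn => ?_⟩⟩
    · obtain ⟨a, ha, e⟩ := hy n (hn.trans (le_max_left _ _))
      exact ⟨a, ha.1, e⟩
    · obtain ⟨a, ha, e⟩ := hy n (hn.trans (le_max_right _ _))
      exact ⟨a, ha.2, e⟩
  isOpen_sUnion S hS x hx := by
    obtain ⟨U, hU, hxU⟩ := hx
    obtain ⟨I, hI, m, h⟩ := hS U hU x hxU
    exact ⟨I, hI, m, fun y hy => ⟨U, hU, h y hy⟩⟩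

/-- The group `S_∞ = ℂ_F^* × ℤ_p`; the multiplicative group `ℂ_F^*` is written additively, so that
`-(x, y) = (x⁻¹, -y)`. -/
abbrev SInfty : Type _ := Additive (CInfty Fq)ˣ × ℤ_[p]

variable {Fq p}

/-- The first coordinate `x ∈ ℂ_F^*` of `s = (x, y) ∈ S_∞`. -/
def SInfty.base (s : SInfty Fq p) : CInfty Fq := (s.1.toMul : (CInfty Fq)ˣ)

variable (Fq p) in
/-- The half-plane `{s = (x, y) ∈ S_∞ : ‖x‖ > 1}`. -/
def halfPlane : Set (SInfty Fq p) := {s | 1 < ‖s.base‖}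

/-- The `i`-th digit `a_i ∈ {0, …, p - 1}` of the `p`-adic expansion `y = a_0 + a_1 p + ⋯`
(`y.appr (i + 1)` is the partial sum `a_0 + ⋯ + a_i p ^ i`). -/
def padicDigit (y : ℤ_[p]) (i : ℕ) : ℕ := y.appr (i + 1) / p ^ i

/-- `u ^ y` for a `1`-unit `u = 1 + m` and `y ∈ ℤ_p`: the limit of the partial products
`∏_{i < n} (1 + m ^ (p ^ i)) ^ a_i`, with `a_i` the `p`-adic digits of `y`. -/
def oneUnitPow (u : CInfty Fq) (y : ℤ_[p]) : CInfty Fq :=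
  Filter.limUnder Filter.atTop fun n : ℕ =>
    ∏ i ∈ Finset.range n, (1 + (u - 1) ^ p ^ i) ^ padicDigit y i

/-- The `1`-unit part `⟨f⟩ = π ^ (-v_∞(f)) f` of a monic polynomial `f`, where `π = 1 / T` and
`v_∞(f) = -deg f`. -/
def oneUnitPart (f : Fq[X]) : CInfty Fq :=
  toCInfty Fq ((RatFunc.X⁻¹) ^ f.natDegree * algebraMap Fq[X] (RatFunc Fq) f)

/-- The exponential `f ^ s = x ^ (deg f) ⟨f⟩ ^ y` for `f` monic and `s = (x, y) ∈ S_∞`. -/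
def gossPow (f : Fq[X]) (s : SInfty Fq p) : CInfty Fq :=
  s.base ^ f.natDegree * oneUnitPow (oneUnitPart f) s.2

end Analytic

section Arithmetic

variable (Fq : Type*) [Field Fq] (K : Type*) [Field K] [Algebra Fq[X] K] [Algebra (RatFunc Fq) K]
  [IsScalarTower Fq[X] (RatFunc Fq) K] [FunctionField Fq K] [Algebra.IsSeparable (RatFunc Fq) K]

/-- `𝓞_K`, the integral closure of `𝔽_q[T]` in `K`. -/
abbrev OK : Type _ := FunctionField.ringOfIntegers Fq K

variable {Fq} in
/-- The monic generator of a nonzero ideal of `𝔽_q[T]`. -/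
def monicGenerator (I : Ideal Fq[X]) : Fq[X] :=
  Submodule.IsPrincipal.generator I * C (Submodule.IsPrincipal.generator I).leadingCoeff⁻¹

variable {K} in
/-- The norm of a nonzero ideal of `𝓞_K`: it is multiplicative, and sends a prime `𝔓` to `f ^ d`,
where `f` is the monic generator of `𝔓 ∩ 𝔽_q[T]` and `d` is the inertia degree of `𝔓`. -/
def idealNorm (I : Ideal (OK Fq K)) : Fq[X] :=
  ((UniqueFactorizationMonoid.normalizedFactors I).map fun P =>
    monicGenerator (P.under Fq[X]) ^ P.inertiaDeg Fq[X]).prod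

/-- `B_K(f)`, the number of ideals of `𝓞_K` with norm `f`. -/
def idealCount (f : Fq[X]) : ℕ :=
  Nat.card {I : Ideal (OK Fq K) // I ≠ ⊥ ∧ idealNorm Fq I = f}

variable {Fq} in
theorem finite_primesOver (𝔭 : Ideal Fq[X]) : (𝔭.primesOver (OK Fq K)).Finite :=
  Algebra.QuasiFinite.finite_primesOver 𝔭

variable {Fq} in
/-- The splitting type `f_K(𝔭) = (f_1, …, f_r)`, `f_1 ≤ ⋯ ≤ f_r`: the inertia degrees of the primes
of `𝓞_K` above `𝔭`, in increasing order. -/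
def splittingType (𝔭 : Ideal Fq[X]) : List ℕ :=
  ((finite_primesOver K 𝔭).toFinset.val.map fun P => P.inertiaDeg Fq[X]).sort (· ≤ ·)

end Arithmetic

section Zeta

variable (Fq : Type*) [Field Fq]

/-- `K` and `L` are arithmetically equivalent over `𝔽_q(T)` with no exceptions: every nonzero prime
of `𝔽_q[T]` has the same splitting type in `K` and in `L`. -/
def ArithEquivNoExceptions
    (K : Type*) [Field K] [Algebra Fq[X] K] [Algebra (RatFunc Fq) K]
    [IsScalarTower Fq[X] (RatFunc Fq) K] [FunctionField Fq K] [Algebra.IsSeparable (RatFunc Fq) K]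
    (L : Type*) [Field L] [Algebra Fq[X] L] [Algebra (RatFunc Fq) L]
    [IsScalarTower Fq[X] (RatFunc Fq) L] [FunctionField Fq L] [Algebra.IsSeparable (RatFunc Fq) L] :
    Prop :=
  ∀ 𝔭 : Ideal Fq[X], 𝔭.IsPrime → 𝔭 ≠ ⊥ → splittingType K 𝔭 = splittingType L 𝔭

variable [Finite Fq] (K : Type*) [Field K] [Algebra Fq[X] K] [Algebra (RatFunc Fq) K]
  [IsScalarTower Fq[X] (RatFunc Fq) K] [FunctionField Fq K] [Algebra.IsSeparable (RatFunc Fq) K]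
  {p : ℕ} [Fact p.Prime]

/-- The term `χ(N(I) ^ (-s)) ∈ W` of the lifted Goss zeta function, with `χ` the Teichmüller
character. -/
def zetaTerm (s : SInfty Fq p) (I : {I : Ideal (OK Fq K) // I ≠ ⊥}) : W Fq p :=
  WittVector.teichmuller p (gossPow (idealNorm Fq I.1) (-s))

/-- The lifted Goss zeta function `∑_I χ(N(I) ^ (-s))`, the sum over the nonzero ideals of `𝓞_K`
being taken in the weak topology of `W`. -/
def liftedGossZeta (s : SInfty Fq p) : W Fq p := ∑' I, zetaTerm Fq K s I

end Zeta

end GossZeta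

end

/-!
Both equivalences compare `K` and `L` through the numbers `B_K(f)` of ideals of given norm.

The weak topology on `W` is a group topology: the Witt vectors whose first components have absolute
value at most `r ≤ 1` form subgroups (`wittBall`), because a Witt vector with components in an ideal
`I` of the ring of integers is one that vanishes over the quotient by `I`. Modulo such an ideal all
but finitely many terms of the zeta function vanish, so that the components of the partial sums are
Cauchy, and completeness of `ℂ_F` gives convergence (`summable_teichmuller`).

If `B_K = B_L`, a norm-preserving bijection between the nonzero ideals matches the two series term
by term. Conversely, let `s = (u⁻¹, -n)` with `‖u‖ < 1` and `n ∈ ℕ`. The zeta function becomes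
`∑_f B_K(f) χ(u ^ deg f) χ(⟨f⟩) ^ n`. Once the coefficients in degrees below `d` are known to agree,
dividing by `χ(u ^ d)` and letting `u → 0` isolates the terms of degree `d`
(`leading_difference_mem_wittBall`): `∑_{deg f = d} (B_K(f) - B_L(f)) χ(⟨f⟩) ^ n = 0` for every `n`.
The powers `n ↦ χ(⟨f⟩) ^ n` are distinct characters with values in a domain of characteristic
zero, so Dedekind's lemma gives `B_K(f) = B_L(f)`.

Finally, by unique factorization, `B_K(f)` counts multisets of primes whose norms multiply to `f`.
Such a multiset is a single prime of norm `f` or consists of primes of norms of smaller degree, so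
by induction on the degree the numbers `B_K(f)` and the numbers of primes of given norm determine
each other (`card_fiber_eq_of_card_prod_map_eq`). The norm of a prime determines the prime below and
the inertia degree, so the latter numbers amount to the splitting types.
-/

noncomputable section

/-! ### Teichmüller representatives in Witt vectors -/

namespace WittVector

variable {p : ℕ} [hp : Fact p.Prime] {R : Type*} [CommRing R]

theorem eq_teichmuller_add_verschiebung (x : WittVector p R) :
    x = teichmuller p (x.coeff 0) + verschiebung (x.shift 1) := by
  ext n
  rw [coeff_add_of_disjoint]
  · cases n with
    | zero => simp
    | succ n => simp [verschiebung_coeff_succ, shift_coeff, add_comm]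
  · intro n
    cases n with
    | zero => simp
    | succ n => simp

theorem frobenius_teichmuller [CharP R p] (c : R) :
    frobenius (teichmuller p c) = teichmuller p (c ^ p) := by
  rw [frobenius_eq_map_frobenius, map_teichmuller, _root_.frobenius_def]

theorem coeff_teichmuller_mul [CharP R p] (c : R) (x : WittVector p R) (n : ℕ) :
    (teichmuller p c * x).coeff n = c ^ p ^ n * x.coeff n := by
  induction n generalizing c x with
  | zero => simp [mul_coeff_zero]
  | succ n ih =>
    conv_lhs => rw [eq_teichmuller_add_verschiebung x]
    rw [mul_add, ← map_mul, mul_comm _ (verschiebung _), ← verschiebung_mul_frobenius,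
      coeff_add_of_disjoint, verschiebung_coeff_succ, teichmuller_coeff_pos _ _ _ n.succ_pos,
      frobenius_teichmuller, mul_comm _ (teichmuller p _), ih, shift_coeff, zero_add, ← pow_mul,
      pow_succ', add_comm 1 n]
    intro n
    cases n with
    | zero => simp
    | succ n => exact Or.inl (teichmuller_coeff_pos _ _ _ n.succ_pos)

theorem charZero_of_charP [CharP R p] [IsDomain R] : CharZero (WittVector p R) := by
  refine charZero_of_inj_zero fun n hn => ?_
  by_contra h0
  obtain ⟨k, m, hm, rfl⟩ := Nat.exists_eq_pow_mul_and_not_dvd h0 p hp.out.ne_one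
  rw [Nat.cast_mul, Nat.cast_pow, mul_eq_zero] at hn
  rcases hn with h | h
  · exact pow_ne_zero _ (p_nonzero p R) h
  · have : ((m : WittVector p R)).coeff 0 = (m : R) := map_natCast constantCoeff m
    rw [h, zero_coeff] at this
    exact hm ((CharP.cast_eq_zero_iff R p m).1 this.symm)

theorem teichmuller_injective : Function.Injective (teichmuller p : R →* WittVector p R) :=
  fun a b h => by simpa using congrArg (fun x => x.coeff 0) h

end WittVector

/-! ### The weak topology -/

namespace GossZeta

variable {Fq : Type*} [Field Fq] [Finite Fq]

/-- The ideal `{x : ‖x‖ ≤ r}` of the ring of integers of `ℂ_F`. -/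
def ballIdeal (Fq : Type*) [Field Fq] [Finite Fq] (r : ℝ≥0) : Ideal (CInftyInt Fq) where
  carrier := {x | ‖(x : CInfty Fq)‖ ≤ r}
  zero_mem' := by simp
  add_mem' {x y} hx hy := (IsUltrametricDist.norm_add_le_max _ _).trans (max_le hx hy)
  smul_mem' a x hx := by
    have ha : ‖(a : CInfty Fq)‖ ≤ 1 := a.2
    have := mul_le_mul ha hx (norm_nonneg _) zero_le_one
    simpa using this

theorem mem_ballIdeal {r : ℝ≥0} {x : CInftyInt Fq} :
    x ∈ ballIdeal Fq r ↔ ‖(x : CInfty Fq)‖ ≤ r := Iff.rfl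

theorem isOpen_ballIdeal {r : ℝ≥0} (hr : 0 < r) : IsOpen (ballIdeal Fq r : Set (CInftyInt Fq)) := by
  have : IsOpen (Metric.closedBall (0 : CInfty Fq) r) :=
    IsUltrametricDist.isOpen_closedBall _ (by exact_mod_cast hr.ne')
  convert this.preimage (continuous_subtype_val (p := fun x => x ∈ CInftyInt Fq)) using 1
  ext x
  simp [mem_ballIdeal]

theorem exists_ballIdeal_le {I : Ideal (CInftyInt Fq)} (hI : IsOpen (I : Set (CInftyInt Fq))) :
    ∃ r : ℝ≥0, 0 < r ∧ r ≤ 1 ∧ ballIdeal Fq r ≤ I := by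
  obtain ⟨ε, hε, h⟩ := Metric.isOpen_iff.1 hI 0 I.zero_mem
  lift ε to ℝ≥0 using hε.le
  refine ⟨min (ε / 2) 1, lt_min (half_pos hε) one_pos, min_le_right _ _, fun x hx => h ?_⟩
  · have h1 : ‖(x : CInfty Fq)‖ ≤ ε / 2 := (mem_ballIdeal.1 hx).trans (by
      exact_mod_cast min_le_left _ _)
    rw [Metric.mem_ball, Subtype.dist_eq, dist_eq_norm]
    simp
    linarith

variable {p : ℕ} [Fact p.Prime]

theorem map_mk_eq_zero_iff {r : ℝ≥0} (X : WittVector p (CInftyInt Fq)) :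
    WittVector.map (Ideal.Quotient.mk (ballIdeal Fq r)) X = 0 ↔
      ∀ n, ‖(X.coeff n : CInfty Fq)‖ ≤ r := by
  simp [WittVector.ext_iff, Ideal.Quotient.eq_zero_iff_mem, mem_ballIdeal]

/-- A Witt vector whose first components lie in the ideal `{x : ‖x‖ ≤ r}` agrees in these components
with an integral one that vanishes modulo this ideal. This turns closure of such Witt vectors under
addition into a statement about a kernel. -/
theorem exists_integral_lift {r : ℝ≥0} (hr : r ≤ 1) {m : ℕ} {x : W Fq p}
    (hx : ∀ n ≤ m, ‖x.coeff n‖ ≤ r) :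
    ∃ X : WittVector p (CInftyInt Fq),
      WittVector.map (Ideal.Quotient.mk (ballIdeal Fq r)) X = 0 ∧
      WittVector.truncate (m + 1) (WittVector.map (CInftyInt Fq).subtype X) =
        WittVector.truncate (m + 1) x := by
  refine ⟨WittVector.mk p fun n => if h : n ≤ m then
    ⟨x.coeff n, (hx n h).trans (by exact_mod_cast hr)⟩ else 0, ?_, ?_⟩
  · rw [map_mk_eq_zero_iff]
    intro n
    rw [WittVector.coeff_mk]
    split_ifs with h
    · exact hx n h
    · simp
  · ext i
    rw [WittVector.coeff_truncate, WittVector.coeff_truncate, WittVector.map_coeff,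
      WittVector.coeff_mk, dif_pos (Nat.lt_succ_iff.1 i.2)]
    rfl

theorem norm_coeff_le_of_lift {r : ℝ≥0} {m : ℕ} {x : W Fq p} {X : WittVector p (CInftyInt Fq)}
    (h0 : WittVector.map (Ideal.Quotient.mk (ballIdeal Fq r)) X = 0)
    (h : WittVector.truncate (m + 1) (WittVector.map (CInftyInt Fq).subtype X) =
      WittVector.truncate (m + 1) x) :
    ∀ n ≤ m, ‖x.coeff n‖ ≤ r := by
  intro n hn
  have := congrArg (fun y => y.coeff ⟨n, Nat.lt_succ_iff.2 hn⟩) h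
  simp only [WittVector.coeff_truncate, WittVector.map_coeff] at this
  rw [← this]
  exact (map_mk_eq_zero_iff X).1 h0 n

variable (Fq p) in
/-- The subgroup of Witt vectors whose components `x_0, …, x_m` have absolute value at most
`r ≤ 1`. These subgroups are a fundamental system of neighbourhoods of `0`. -/
def wittBall (r : ℝ≥0) (hr : r ≤ 1) (m : ℕ) : AddSubgroup (W Fq p) where
  carrier := {x | ∀ n ≤ m, ‖x.coeff n‖ ≤ r}
  zero_mem' := by simp
  add_mem' {x y} hx hy := by
    obtain ⟨X, hX, hX'⟩ := exists_integral_lift hr hx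
    obtain ⟨Y, hY, hY'⟩ := exists_integral_lift hr hy
    exact norm_coeff_le_of_lift (X := X + Y) (by rw [map_add, hX, hY, add_zero])
      (by simp only [map_add, hX', hY'])
  neg_mem' {x} hx := by
    obtain ⟨X, hX, hX'⟩ := exists_integral_lift hr hx
    exact norm_coeff_le_of_lift (X := -X) (by rw [map_neg, hX, neg_zero])
      (by simp only [map_neg, hX'])

theorem mem_wittBall {r : ℝ≥0} {hr : r ≤ 1} {m : ℕ} {x : W Fq p} :
    x ∈ wittBall Fq p r hr m ↔ ∀ n ≤ m, ‖x.coeff n‖ ≤ r := Iff.rfl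

theorem wittBall_subset_basicNhd {r : ℝ≥0} {hr : r ≤ 1} {I : Ideal (CInftyInt Fq)}
    (h : ballIdeal Fq r ≤ I) (m : ℕ) {x : W Fq p} (hx : x ∈ wittBall Fq p r hr m) :
    x ∈ basicNhd Fq p I m := fun n hn =>
  ⟨⟨x.coeff n, (hx n hn).trans (by exact_mod_cast hr)⟩, h (hx n hn), rfl⟩

theorem basicNhd_ballIdeal_subset {r : ℝ≥0} {hr : r ≤ 1} {m : ℕ} {x : W Fq p}
    (hx : x ∈ basicNhd Fq p (ballIdeal Fq r) m) : x ∈ wittBall Fq p r hr m := fun n hn => by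
  obtain ⟨a, ha, e⟩ := hx n hn
  rw [← e]
  exact ha

theorem isOpen_iff_wittBall {U : Set (W Fq p)} :
    IsOpen U ↔ ∀ x ∈ U, ∃ (r : ℝ≥0) (hr : r ≤ 1) (m : ℕ), 0 < r ∧
      ∀ y, y - x ∈ wittBall Fq p r hr m → y ∈ U := by
  constructor
  · intro h x hx
    obtain ⟨I, hI, m, hm⟩ := h x hx
    obtain ⟨r, hr0, hr1, hr⟩ := exists_ballIdeal_le hI
    exact ⟨r, hr1, m, hr0, fun y hy => hm y (wittBall_subset_basicNhd hr m hy)⟩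
  · intro h x hx
    obtain ⟨r, hr1, m, hr0, hm⟩ := h x hx
    exact ⟨ballIdeal Fq r, isOpen_ballIdeal hr0, m,
      fun y hy => hm y (basicNhd_ballIdeal_subset hy)⟩

/-- That the `wittBall`s are subgroups makes their cosets open, so they describe the
neighbourhoods of every point. -/
theorem mem_nhds_iff_wittBall {S : Set (W Fq p)} {x : W Fq p} :
    S ∈ nhds x ↔ ∃ (r : ℝ≥0) (hr : r ≤ 1) (m : ℕ), 0 < r ∧
      ∀ y, y - x ∈ wittBall Fq p r hr m → y ∈ S := by
  rw [mem_nhds_iff]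
  constructor
  · rintro ⟨U, hUS, hU, hx⟩
    obtain ⟨r, hr1, m, hr0, hm⟩ := isOpen_iff_wittBall.1 hU x hx
    exact ⟨r, hr1, m, hr0, fun y hy => hUS (hm y hy)⟩
  · rintro ⟨r, hr1, m, hr0, hm⟩
    refine ⟨{y | y - x ∈ wittBall Fq p r hr1 m}, hm, ?_, ?_⟩
    · refine isOpen_iff_wittBall.2 fun z hz => ⟨r, hr1, m, hr0, fun y hy => ?_⟩
      have := (wittBall Fq p r hr1 m).add_mem hy hz
      rwa [sub_add_sub_cancel] at this
    · simp [(wittBall Fq p r hr1 m).zero_mem]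

theorem teichmuller_mem_wittBall {r : ℝ≥0} {hr : r ≤ 1} {m : ℕ} {c : CInfty Fq} (hc : ‖c‖ ≤ r) :
    WittVector.teichmuller p c ∈ wittBall Fq p r hr m := by
  intro n _
  rcases n.eq_zero_or_pos with rfl | hn
  · simpa using hc
  · simp [WittVector.teichmuller_coeff_pos p c n hn]

/-- In the weak topology, a family of Teichmüller representatives of integral elements tending to
`0` is summable. -/
theorem summable_teichmuller {ι : Type*} {g : ι → CInfty Fq} (h1 : ∀ i, ‖g i‖ ≤ 1)
    (h0 : ∀ r : ℝ≥0, 0 < r → {i | (r : ℝ) < ‖g i‖}.Finite) :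
    Summable fun i => (WittVector.teichmuller p (g i) : W Fq p) := by
  classical
  let G : ι → CInftyInt Fq := fun i => ⟨g i, h1 i⟩
  let S : Finset ι → WittVector p (CInftyInt Fq) := fun s =>
    ∑ i ∈ s, WittVector.teichmuller p (G i)
  -- Modulo an ideal `{x : ‖x‖ ≤ r}` only finitely many terms survive, so that the partial sums
  -- are eventually constant in all components at once.
  have key : ∀ r : ℝ≥0, 0 < r → ∃ s₀ : Finset ι, ∀ s t, s₀ ⊆ s → s₀ ⊆ t → ∀ n,
      ‖((S s).coeff n - (S t).coeff n : CInfty Fq)‖ ≤ r := by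
    intro r hr
    let φ := Ideal.Quotient.mk (ballIdeal Fq r)
    have hS : ∀ s, (h0 r hr).toFinset ⊆ s →
        WittVector.map φ (S s) = WittVector.map φ (S (h0 r hr).toFinset) := by
      intro s hs
      simp only [S, map_sum, WittVector.map_teichmuller]
      refine (Finset.sum_subset hs fun i _ hi => ?_).symm
      have : φ (G i) = 0 := Ideal.Quotient.eq_zero_iff_mem.2 (mem_ballIdeal.2 (by simpa using hi))
      rw [this, WittVector.teichmuller_zero]
    refine ⟨(h0 r hr).toFinset, fun s t hs ht n => ?_⟩
    have h := congrArg (fun x => x.coeff n) ((hS s hs).trans (hS t ht).symm)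
    simp only [WittVector.map_coeff, φ] at h
    exact mem_ballIdeal.1 (Ideal.Quotient.eq.1 h)
  have hlim : ∀ n, ∃ z : CInfty Fq,
      Filter.Tendsto (fun s => ((S s).coeff n : CInfty Fq)) Filter.atTop (nhds z) := by
    intro n
    refine cauchySeq_tendsto_of_complete (Metric.cauchySeq_iff'.2 fun ε hε => ?_)
    lift ε to ℝ≥0 using hε.le
    obtain ⟨s₀, hs₀⟩ := key (ε / 2) (half_pos hε)
    refine ⟨s₀, fun s hs => ?_⟩
    rw [dist_eq_norm]
    refine (hs₀ s s₀ hs (Finset.Subset.refl _) n).trans_lt ?_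
    push_cast
    exact half_lt_self hε
  choose z hz using hlim
  have hz1 : ∀ n, ‖z n‖ ≤ 1 := fun n =>
    le_of_tendsto (hz n).norm (Filter.Eventually.of_forall fun s => ((S s).coeff n).2)
  let Z : WittVector p (CInftyInt Fq) := WittVector.mk p fun n => ⟨z n, hz1 n⟩
  refine ⟨WittVector.map (CInftyInt Fq).subtype Z, ?_⟩
  rw [HasSum, SummationFilter.unconditional_filter, Filter.tendsto_def]
  intro T hT
  obtain ⟨r, hr1, m, hr0, hT⟩ := mem_nhds_iff_wittBall.1 hT
  obtain ⟨s₀, hs₀⟩ := key r hr0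
  refine Filter.mem_atTop_sets.2 ⟨s₀, fun s hs => hT _ ?_⟩
  beta_reduce
  have hdiff : WittVector.map (Ideal.Quotient.mk (ballIdeal Fq r)) (S s - Z) = 0 := by
    rw [map_sub, sub_eq_zero]
    ext n
    rw [WittVector.map_coeff, WittVector.map_coeff, Ideal.Quotient.eq, mem_ballIdeal]
    have hlim : Filter.Tendsto (fun t => ((S s).coeff n : CInfty Fq) - (S t).coeff n)
        Filter.atTop (nhds ((S s).coeff n - z n)) := tendsto_const_nhds.sub (hz n)
    exact le_of_tendsto hlim.norm
      (Filter.eventually_atTop.2 ⟨s₀, fun t ht => hs₀ s t hs ht n⟩)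
  have hsum : ∑ i ∈ s, (WittVector.teichmuller p (g i) : W Fq p) =
      WittVector.map (CInftyInt Fq).subtype (S s) := by
    simp only [S, map_sum, WittVector.map_teichmuller]
    rfl
  rw [hsum, ← map_sub]
  exact norm_coeff_le_of_lift hdiff rfl

end GossZeta

/-! ### Counting multisets of polynomials -/

namespace GossZeta

/-- Two maps with finite fibres of equal cardinalities differ by a bijection of their sources. -/
theorem exists_equiv_of_card_fiber_eq {α β γ : Type*} {f : α → γ} {g : β → γ}
    (hf : ∀ c, Finite {a // f a = c}) (hg : ∀ c, Finite {b // g b = c})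
    (h : ∀ c, Nat.card {a // f a = c} = Nat.card {b // g b = c}) :
    ∃ e : α ≃ β, ∀ a, g (e a) = f a := by
  have e := fun c => (Finite.card_eq.1 (h c)).some
  refine ⟨(Equiv.sigmaFiberEquiv f).symm.trans
    ((Equiv.sigmaCongrRight e).trans (Equiv.sigmaFiberEquiv g)), fun a => ?_⟩
  exact (e (f a) ⟨a, rfl⟩).2

theorem card_fiber_eq_of_equiv {α β γ : Type*} {f : α → γ} {g : β → γ} (e : α ≃ β)
    (he : ∀ a, g (e a) = f a) (c : γ) :
    Nat.card {a // f a = c} = Nat.card {b // g b = c} :=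
  Nat.card_congr (e.subtypeEquiv fun a => by rw [he])

section Multiset

variable {F : Type*} [Field F] {ι κ : Type*} {N : ι → F[X]} {N' : κ → F[X]}

theorem monic_prod_map (hN : ∀ i, (N i).Monic) (s : Multiset ι) : (s.map N).prod.Monic :=
  monic_multiset_prod_of_monic _ _ fun i _ => hN i

theorem natDegree_prod_map (hN : ∀ i, (N i).Monic) (s : Multiset ι) :
    (s.map N).prod.natDegree = (s.map fun i => (N i).natDegree).sum := by
  rw [natDegree_multiset_prod_of_monic, Multiset.map_map]
  · rfl
  · intro f hf
    obtain ⟨i, _, rfl⟩ := Multiset.mem_map.1 hf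
    exact hN i

theorem card_le_natDegree_prod_map (hN : ∀ i, (N i).Monic) (hpos : ∀ i, 0 < (N i).natDegree)
    (s : Multiset ι) : s.card ≤ (s.map N).prod.natDegree := by
  rw [natDegree_prod_map hN]
  have := Multiset.card_nsmul_le_sum (s := s.map fun i => (N i).natDegree) (a := 1) (by
    intro x hx
    obtain ⟨i, _, rfl⟩ := Multiset.mem_map.1 hx
    exact hpos i)
  simpa using this

theorem natDegree_le_natDegree_prod_map (hN : ∀ i, (N i).Monic) {s : Multiset ι} {i : ι}
    (hi : i ∈ s) : (N i).natDegree ≤ (s.map N).prod.natDegree := by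
  rw [natDegree_prod_map hN]
  exact Multiset.single_le_sum (fun _ _ => Nat.zero_le _) _
    (Multiset.mem_map_of_mem (fun i => (N i).natDegree) hi)

theorem finite_natDegree_prod_map_le (hN : ∀ i, (N i).Monic) (hpos : ∀ i, 0 < (N i).natDegree)
    (hfin : ∀ d, {i | (N i).natDegree ≤ d}.Finite) (d : ℕ) :
    {s : Multiset ι | (s.map N).prod.natDegree ≤ d}.Finite := by
  classical
  refine (Set.finite_Iic (d • (hfin d).toFinset.val)).subset fun s hs => ?_
  rw [Set.mem_Iic, Multiset.le_iff_count]
  intro i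
  by_cases hi : i ∈ s
  · have hmem : i ∈ (hfin d).toFinset := by
      simpa using (natDegree_le_natDegree_prod_map hN hi).trans hs
    rw [Multiset.count_nsmul, Multiset.count_eq_one_of_mem (Finset.nodup _) hmem, mul_one]
    exact (Multiset.count_le_card _ _).trans ((card_le_natDegree_prod_map hN hpos s).trans hs)
  · simp [Multiset.count_eq_zero_of_notMem hi]

/-- A multiset whose product is `g` either is a single element of norm `g`, or consists of elements
of norms of smaller degree. -/
theorem card_prod_map_eq (hN : ∀ i, (N i).Monic) (hpos : ∀ i, 0 < (N i).natDegree)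
    (hfin : ∀ d, {i | (N i).natDegree ≤ d}.Finite) (g : F[X]) :
    Nat.card {s : Multiset ι // (s.map N).prod = g} = Nat.card {i // N i = g} +
      Nat.card {s : Multiset {i // (N i).natDegree < g.natDegree} //
        (s.map fun i => N i.1).prod = g} := by
  have hinj : Function.Injective
      (Multiset.map (Subtype.val : {i // (N i).natDegree < g.natDegree} → ι)) :=
    Multiset.map_injective Subtype.val_injective
  have hsplit : {s : Multiset ι | (s.map N).prod = g} =
      (fun i => ({i} : Multiset ι)) '' {i | N i = g} ∪
      Multiset.map Subtype.val '' {s : Multiset {i // (N i).natDegree < g.natDegree} |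
        (s.map fun i => N i.1).prod = g} := by
    ext s
    simp only [Set.mem_ofPred_eq, Set.mem_union, Set.mem_image]
    constructor
    · intro hs
      by_cases h : ∀ i ∈ s, (N i).natDegree < g.natDegree
      · refine Or.inr ⟨s.attach.map fun i => ⟨i.1, h i.1 i.2⟩, ?_, ?_⟩
        · rw [Multiset.map_map]
          exact (congrArg Multiset.prod (Multiset.attach_map_val' s N)).trans hs
        · rw [Multiset.map_map]
          exact Multiset.attach_map_val s
      · push Not at h
        obtain ⟨i, hi, hle⟩ := h
        obtain ⟨t, rfl⟩ := Multiset.exists_cons_of_mem hi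
        rw [Multiset.map_cons, Multiset.prod_cons] at hs
        have hdeg := congrArg natDegree hs
        rw [(hN i).natDegree_mul (monic_prod_map hN t)] at hdeg
        have ht : t = 0 := Multiset.card_eq_zero.1
          (Nat.le_zero.1 ((card_le_natDegree_prod_map hN hpos t).trans (by omega)))
        subst ht
        exact Or.inl ⟨i, by simpa using hs, rfl⟩
    · rintro (⟨i, hi, rfl⟩ | ⟨t, ht, rfl⟩)
      · simpa using hi
      · rw [Multiset.map_map]
        exact ht
  have hfinite : {s : Multiset ι | (s.map N).prod = g}.Finite :=
    (finite_natDegree_prod_map_le hN hpos hfin g.natDegree).subset fun s hs =>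
      (congrArg natDegree hs).le
  have hdisj : Disjoint ((fun i => ({i} : Multiset ι)) '' {i | N i = g})
      (Multiset.map Subtype.val '' {s : Multiset {i // (N i).natDegree < g.natDegree} |
        (s.map fun i => N i.1).prod = g}) := by
    rw [Set.disjoint_left]
    rintro _ ⟨i, hi, rfl⟩ ⟨t, -, ht⟩
    have : i ∈ Multiset.map Subtype.val t := ht ▸ Multiset.mem_singleton_self i
    obtain ⟨j, -, rfl⟩ := Multiset.mem_map.1 this
    exact (congrArg natDegree hi).not_lt j.2
  rw [hsplit] at hfinite
  have hcard := Set.ncard_union_eq hdisj (hfinite.subset Set.subset_union_left)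
    (hfinite.subset Set.subset_union_right)
  rw [← hsplit, Set.ncard_image_of_injective _ (fun i j h => Multiset.singleton_inj.1 h),
    Set.ncard_image_of_injective _ hinj] at hcard
  exact hcard

theorem card_multiset_prod_eq_of_equiv (e : ι ≃ κ) (he : ∀ i, N' (e i) = N i) (g : F[X]) :
    Nat.card {s : Multiset ι // (s.map N).prod = g} =
      Nat.card {s : Multiset κ // (s.map N').prod = g} := by
  let E : Multiset ι ≃ Multiset κ :=
    ⟨Multiset.map e, Multiset.map e.symm, fun s => by simp, fun s => by simp⟩
  refine Nat.card_congr (E.subtypeEquiv fun s => ?_)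
  simp [E, Multiset.map_map, he]

theorem card_fiber_subtype_lt (N : ι → F[X]) (d : ℕ) (c : F[X]) :
    Nat.card {i : {i // (N i).natDegree < d} // N i = c} =
      if c.natDegree < d then Nat.card {i // N i = c} else 0 := by
  split_ifs with hc
  · exact Nat.card_congr (Equiv.subtypeSubtypeEquivSubtype fun {i} (hi : N i = c) => by rwa [hi])
  · have : IsEmpty {i : {i // (N i).natDegree < d} // N i = c} :=
      ⟨fun i => hc (i.2 ▸ i.1.2)⟩
    exact Nat.card_of_isEmpty

theorem finite_subtype_natDegree_lt (hfin : ∀ d, {i | (N i).natDegree ≤ d}.Finite) (d : ℕ) :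
    Finite {i // (N i).natDegree < d} :=
  Set.Finite.to_subtype (s := {i | (N i).natDegree < d})
    ((hfin d).subset fun _ hi => Nat.le_of_lt hi)

/-- The numbers of multisets with given product determine the numbers of elements of given norm. -/
theorem card_fiber_eq_of_card_prod_map_eq
    (hN : ∀ i, (N i).Monic) (hpos : ∀ i, 0 < (N i).natDegree)
    (hfin : ∀ d, {i | (N i).natDegree ≤ d}.Finite)
    (hN' : ∀ i, (N' i).Monic) (hpos' : ∀ i, 0 < (N' i).natDegree)
    (hfin' : ∀ d, {i | (N' i).natDegree ≤ d}.Finite)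
    (h : ∀ g : F[X], g.Monic → Nat.card {s : Multiset ι // (s.map N).prod = g} =
      Nat.card {s : Multiset κ // (s.map N').prod = g}) (g : F[X]) :
    Nat.card {i // N i = g} = Nat.card {j // N' j = g} := by
  induction hd : g.natDegree using Nat.strong_induction_on generalizing g with
  | _ d ih =>
    subst hd
    by_cases hg : g.Monic
    · have := finite_subtype_natDegree_lt hfin g.natDegree
      have := finite_subtype_natDegree_lt hfin' g.natDegree
      obtain ⟨e, he⟩ := exists_equiv_of_card_fiber_eq
        (f := fun i : {i // (N i).natDegree < g.natDegree} => N i)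
        (g := fun j : {j // (N' j).natDegree < g.natDegree} => N' j)
        (fun _ => inferInstance) (fun _ => inferInstance) fun c => by
          rw [card_fiber_subtype_lt, card_fiber_subtype_lt]
          split_ifs with hc
          · exact ih _ hc c rfl
          · rfl
      have := h g hg
      rw [card_prod_map_eq hN hpos hfin, card_prod_map_eq hN' hpos' hfin',
        card_multiset_prod_eq_of_equiv (N := fun i : {i // (N i).natDegree < g.natDegree} => N i)
          (N' := fun j : {j // (N' j).natDegree < g.natDegree} => N' j) e he] at this
      exact Nat.add_right_cancel this
    · have : IsEmpty {i // N i = g} := ⟨fun i => hg (i.2 ▸ hN i)⟩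
      have : IsEmpty {j // N' j = g} := ⟨fun j => hg (j.2 ▸ hN' j)⟩
      rw [Nat.card_of_isEmpty, Nat.card_of_isEmpty]

end Multiset

end GossZeta

/-! ### Powers of one-units -/

namespace GossZeta

theorem appr_add_digit {p : ℕ} [Fact p.Prime] (y : ℤ_[p]) (i : ℕ) :
    y.appr (i + 1) = y.appr i + p ^ i * padicDigit y i := by
  have hdvd : p ^ i ∣ y.appr (i + 1) - y.appr i := PadicInt.dvd_appr_sub_appr y i (i + 1) i.le_succ
  obtain ⟨k, hk⟩ := hdvd
  have h1 : y.appr (i + 1) = y.appr i + p ^ i * k := by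
    have := PadicInt.appr_mono y i.le_succ
    simp only [Nat.succ_eq_add_one] at this
    omega
  rw [padicDigit, h1, Nat.add_mul_div_left _ _ (pow_pos (Fact.out : p.Prime).pos i),
    Nat.div_eq_of_lt (PadicInt.appr_lt y i), zero_add]

theorem appr_natCast {p : ℕ} [Fact p.Prime] (n : ℕ) {k : ℕ} (h : n < p ^ k) :
    (n : ℤ_[p]).appr k = n := by
  have h1 := PadicInt.appr_spec k (n : ℤ_[p])
  have h2 := PadicInt.appr_lt (n : ℤ_[p]) k
  rw [← PadicInt.ker_toZModPow, RingHom.mem_ker, map_sub, map_natCast, map_natCast, sub_eq_zero,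
    ZMod.natCast_eq_natCast_iff, Nat.ModEq, Nat.mod_eq_of_lt h, Nat.mod_eq_of_lt h2] at h1
  exact h1.symm

section

variable {Fq : Type*} [Field Fq] [Finite Fq] {p : ℕ} [Fact p.Prime] [CharP Fq p]

instance CInfty.charP : CharP (CInfty Fq) p :=
  have : CharP (RatFunc Fq) p := charP_of_injective_algebraMap (algebraMap Fq (RatFunc Fq)).injective p
  charP_of_injective_ringHom (toCInfty Fq).injective p

open scoped Classical in
theorem norm_toCInfty_lt_one_iff (x : RatFunc Fq) :
    ‖toCInfty Fq x‖ < 1 ↔ RatFunc.inftyValuation Fq x < 1 := by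
  have hv : Valued.v (algebraMap (RatFunc Fq) (FInfty Fq) x) = RatFunc.inftyValuation Fq x :=
    @Valued.extensionValuation_apply_coe (RatFunc Fq) _ _ _ (RatFunc.inftyValued Fq) x
  have hn : ‖toCInfty Fq x‖ = ‖algebraMap (RatFunc Fq) (FInfty Fq) x‖ :=
    (UniformSpace.Completion.norm_coe
      (algebraMap (FInfty Fq) (FInftyAlg Fq) (algebraMap (RatFunc Fq) (FInfty Fq) x))).trans
      (norm_algebraMap' (FInftyAlg Fq) (algebraMap (RatFunc Fq) (FInfty Fq) x))
  rw [hn, ← hv]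
  exact Valued.toNormedField.norm_lt_one_iff

/-- In characteristic `p` the partial products defining `u ^ y` are the powers of `u` whose
exponents are the truncations of `y`. -/
theorem prod_padicDigit (u : CInfty Fq) (y : ℤ_[p]) (n : ℕ) :
    ∏ i ∈ Finset.range n, (1 + (u - 1) ^ p ^ i) ^ padicDigit y i = u ^ y.appr n := by
  induction n with
  | zero => simp [PadicInt.appr]
  | succ n ih =>
    rw [Finset.prod_range_succ, ih, appr_add_digit, pow_add, pow_mul, sub_pow_char_pow, one_pow,
      add_sub_cancel]

theorem oneUnitPow_natCast (u : CInfty Fq) (n : ℕ) : oneUnitPow u (n : ℤ_[p]) = u ^ n := by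
  refine Filter.Tendsto.limUnder_eq (tendsto_const_nhds.congr' ?_)
  refine Filter.eventually_atTop.2 ⟨n, fun k hk => ?_⟩
  beta_reduce
  rw [prod_padicDigit, appr_natCast]
  exact hk.trans_lt (Nat.lt_pow_self (Fact.out : p.Prime).one_lt)

theorem norm_eq_one_of_norm_sub_one_lt {u : CInfty Fq} (hu : ‖u - 1‖ < 1) : ‖u‖ = 1 := by
  have := IsUltrametricDist.norm_add_eq_max_of_norm_ne_norm (x := u - 1) (y := 1)
    (by rw [norm_one]; exact hu.ne)
  rwa [sub_add_cancel, norm_one, max_eq_right hu.le] at this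

theorem norm_oneUnit_pow_sub_one_le {u : CInfty Fq} (hu : ‖u - 1‖ < 1) (n : ℕ) :
    ‖u ^ n - 1‖ ≤ ‖u - 1‖ := by
  rw [← mul_geom_sum, norm_mul]
  refine mul_le_of_le_one_right (norm_nonneg _) ?_
  refine IsUltrametricDist.norm_sum_le_of_forall_le_of_nonneg zero_le_one fun i _ => ?_
  rw [norm_pow, norm_eq_one_of_norm_sub_one_lt hu, one_pow]

/-- For a one-unit `u` the limit defining `u ^ y` exists. -/
theorem tendsto_oneUnitPow {u : CInfty Fq} (hu : ‖u - 1‖ < 1) (y : ℤ_[p]) :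
    Filter.Tendsto (fun n => u ^ y.appr n) Filter.atTop (nhds (oneUnitPow u y)) := by
  have hu1 := norm_eq_one_of_norm_sub_one_lt hu
  have hcau : CauchySeq fun n => u ^ y.appr n := by
    refine cauchySeq_of_le_geometric ‖u - 1‖ 1 hu fun n => ?_
    rw [appr_add_digit, pow_add, dist_eq_norm, ← norm_neg, neg_sub, ← mul_sub_one, norm_mul,
      norm_pow, hu1, one_pow, one_mul, one_mul, pow_mul]
    have hlt : ‖u ^ p ^ n - 1‖ < 1 := (norm_oneUnit_pow_sub_one_le hu _).trans_lt hu
    refine (norm_oneUnit_pow_sub_one_le hlt _).trans ?_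
    have : u ^ p ^ n - 1 = (u - 1) ^ p ^ n := by rw [sub_pow_char_pow, one_pow]
    rw [this, norm_pow]
    exact pow_le_pow_of_le_one (norm_nonneg _) hu.le
      (Nat.lt_pow_self (Fact.out : p.Prime).one_lt).le
  have := hcau.tendsto_limUnder
  simpa only [oneUnitPow, prod_padicDigit] using this

theorem norm_oneUnitPow {u : CInfty Fq} (hu : ‖u - 1‖ < 1) (y : ℤ_[p]) : ‖oneUnitPow u y‖ = 1 := by
  refine tendsto_nhds_unique (tendsto_oneUnitPow hu y).norm ?_
  simp [norm_eq_one_of_norm_sub_one_lt hu]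

open scoped Classical in
theorem norm_oneUnitPart_sub_one_lt {f : Fq[X]} (hf : f.Monic) : ‖oneUnitPart f - 1‖ < 1 := by
  have hX : (RatFunc.X : RatFunc Fq) ≠ 0 := RatFunc.X_ne_zero
  have : oneUnitPart f - 1 = toCInfty Fq
      ((RatFunc.X⁻¹) ^ f.natDegree * algebraMap Fq[X] (RatFunc Fq) (f - X ^ f.natDegree)) := by
    rw [oneUnitPart, ← map_one (toCInfty Fq), ← map_sub, map_sub (algebraMap _ _), map_pow,
      RatFunc.algebraMap_X, mul_sub, ← mul_pow, inv_mul_cancel₀ hX, one_pow]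
  rw [this, norm_toCInfty_lt_one_iff]
  rcases eq_or_ne (f - X ^ f.natDegree) 0 with h0 | h0
  · simp [h0]
  · have hdeg : (f - X ^ f.natDegree).natDegree < f.natDegree := by
      refine natDegree_lt_natDegree h0 ?_
      refine degree_sub_lt_left ?_ hf.ne_zero ?_
      · rw [degree_X_pow, degree_eq_natDegree hf.ne_zero]
      · rw [hf.leadingCoeff, (monic_X_pow _).leadingCoeff]
    rw [map_mul, RatFunc.inftyValuation_apply (x := algebraMap _ _ _),
      RatFunc.inftyValuation.polynomial Fq h0, map_pow, map_inv₀, RatFunc.inftyValuation.X,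
      ← WithZero.exp_neg, ← WithZero.exp_nsmul, ← WithZero.exp_add, ← WithZero.exp_zero,
      WithZero.exp_lt_exp]
    simp
    omega

theorem oneUnitPart_inj {f g : Fq[X]} (hd : f.natDegree = g.natDegree)
    (h : oneUnitPart f = oneUnitPart g) : f = g := by
  have := (toCInfty Fq).injective h
  rw [hd] at this
  exact IsFractionRing.injective Fq[X] (RatFunc Fq)
    (mul_left_cancel₀ (pow_ne_zero _ (inv_ne_zero RatFunc.X_ne_zero)) this)

end

end GossZeta

/-! ### The coefficients of a lifted Dirichlet series are determined by its values -/

namespace GossZeta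

variable {Fq : Type*} [Field Fq] [Finite Fq] {p : ℕ} [Fact p.Prime]

theorem exists_finset_sum_sub_mem_wittBall {ι : Type*} {t : ι → W Fq p} {a : W Fq p}
    (h : HasSum t a) (D : Finset ι) {r : ℝ≥0} (hr0 : 0 < r) (hr : r ≤ 1) (m : ℕ) :
    ∃ s : Finset ι, D ⊆ s ∧ ∑ i ∈ s, t i - a ∈ wittBall Fq p r hr m := by
  have hnhds : {y | y - a ∈ wittBall Fq p r hr m} ∈ nhds a :=
    mem_nhds_iff_wittBall.2 ⟨r, hr, m, hr0, fun y hy => hy⟩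
  rw [HasSum, SummationFilter.unconditional_filter] at h
  obtain ⟨s, hs⟩ := ((h.eventually hnhds).and (Filter.eventually_ge_atTop D)).exists
  exact ⟨s, hs.2, hs.1⟩

theorem sum_comp_eq_sum_card_nsmul {ι γ M : Type*} [AddCommMonoid M] (N : ι → γ) (h : γ → M)
    (D : Finset ι) (S : Finset γ) (hD : ∀ i, i ∈ D ↔ N i ∈ S) :
    ∑ i ∈ D, h (N i) = ∑ f ∈ S, Nat.card {i // N i = f} • h f := by
  classical
  rw [← Finset.sum_fiberwise_of_maps_to fun i hi => (hD i).1 hi]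
  refine Finset.sum_congr rfl fun f hf => ?_
  rw [Finset.sum_congr rfl fun i hi => by rw [(Finset.mem_filter.1 hi).2], Finset.sum_const]
  congr 1
  rw [← Nat.card_eq_finsetCard]
  refine Nat.card_congr (Equiv.subtypeEquivRight fun i => ?_)
  rw [Finset.mem_filter, hD]
  exact ⟨fun h => h.2, fun h => ⟨h ▸ hf, h⟩⟩

theorem finite_monic_natDegree_le (F : Type*) [Field F] [Finite F] (d : ℕ) :
    {f : F[X] | f.Monic ∧ f.natDegree ≤ d}.Finite := by
  have : Finite (degreeLT F (d + 1)) := Finite.of_equiv _ (degreeLTEquiv F (d + 1)).symm.toEquiv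
  refine (Set.toFinite (degreeLT F (d + 1) : Set F[X])).subset fun f hf => ?_
  exact mem_degreeLT.2 (degree_le_natDegree.trans_lt (by exact_mod_cast Nat.lt_succ_of_le hf.2))

theorem exists_ne_zero_norm_lt_one (Fq : Type*) [Field Fq] [Finite Fq] :
    ∃ u : CInfty Fq, u ≠ 0 ∧ ‖u‖ < 1 := by
  classical
  refine ⟨toCInfty Fq (RatFunc.X⁻¹), ?_, ?_⟩
  · exact (_root_.map_ne_zero _).2 (inv_ne_zero RatFunc.X_ne_zero)
  · rw [norm_toCInfty_lt_one_iff, map_inv₀, RatFunc.inftyValuation.X, ← WithZero.exp_neg,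
      ← WithZero.exp_zero, WithZero.exp_lt_exp]
    simp

theorem eq_zero_of_forall_mem_wittBall {x : W Fq p}
    (h : ∀ u : CInfty Fq, u ≠ 0 → ∀ hu : ‖u‖₊ < 1, ∀ m, x ∈ wittBall Fq p ‖u‖₊ hu.le m) :
    x = 0 := by
  obtain ⟨u, hu0, hu1⟩ := exists_ne_zero_norm_lt_one Fq
  ext n
  rw [WittVector.zero_coeff, ← norm_le_zero_iff]
  refine ge_of_tendsto (tendsto_pow_atTop_nhds_zero_of_lt_one (norm_nonneg u) hu1)
    (Filter.eventually_atTop.2 ⟨1, fun k hk => ?_⟩)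
  have hk1 : ‖u ^ k‖₊ < 1 := by
    rw [nnnorm_pow]
    exact pow_lt_one₀ (norm_nonneg u) hu1 (by omega)
  have := h (u ^ k) (pow_ne_zero _ hu0) hk1 n n le_rfl
  rwa [coe_nnnorm, norm_pow] at this

variable [CharP Fq p]

/-- Teichmüller representatives of distinct elements satisfy no integral linear relation that
persists under raising them to all powers. -/
theorem eq_zero_of_sum_teichmuller_pow_eq_zero {γ : Type*} (S : Finset γ) (v : γ → CInfty Fq)
    (hv : Set.InjOn v S) (b : γ → ℤ)
    (h : ∀ n : ℕ, ∑ f ∈ S, (b f : W Fq p) * WittVector.teichmuller p (v f) ^ n = 0) :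
    ∀ f ∈ S, b f = 0 := by
  have : CharZero (W Fq p) := WittVector.charZero_of_charP
  let φ : S → Multiplicative ℕ →* W Fq p := fun f => powersHom _ (WittVector.teichmuller p (v f))
  have hφ : Function.Injective φ := fun f g hfg => by
    have := (powersHom (W Fq p)).injective hfg
    exact Subtype.ext (hv f.2 g.2 (WittVector.teichmuller_injective this))
  have hli := (linearIndependent_monoidHom (Multiplicative ℕ) (W Fq p)).comp φ hφ
  intro f hf
  have := Fintype.linearIndependent_iff.1 hli (fun f => (b f : W Fq p)) (by
    ext n
    rw [Finset.sum_apply, Pi.zero_apply, ← h n.toAdd, ← Finset.sum_coe_sort S]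
    rfl) ⟨f, hf⟩
  exact_mod_cast this

/-- Comparing the terms of lowest degree: if two sums of terms `χ(u ^ deg f * v f)` agree and their
terms with `deg f < d` cancel, then the differences of the terms of degree `d` are congruent to `0`
modulo `u`, once `χ(u ^ d)` is divided out. -/
theorem leading_difference_mem_wittBall {γ ι κ : Type*} {δ : γ → ℕ} {v : γ → CInfty Fq}
    {N : ι → γ} {N' : κ → γ} (hv : ∀ i, ‖v (N i)‖ ≤ 1) (hv' : ∀ j, ‖v (N' j)‖ ≤ 1)
    {d : ℕ} {D : Finset ι} {D' : Finset κ} (hD : ∀ i, i ∈ D ↔ δ (N i) ≤ d)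
    (hD' : ∀ j, j ∈ D' ↔ δ (N' j) ≤ d)
    {u : CInfty Fq} (hu0 : u ≠ 0) (hu1 : ‖u‖₊ < 1) {a : W Fq p}
    (ha : HasSum (fun i => WittVector.teichmuller p (u ^ δ (N i) * v (N i))) a)
    (ha' : HasSum (fun j => WittVector.teichmuller p (u ^ δ (N' j) * v (N' j))) a) {c : W Fq p}
    (hc : ∑ i ∈ D, WittVector.teichmuller p (u ^ δ (N i) * v (N i)) -
      ∑ j ∈ D', WittVector.teichmuller p (u ^ δ (N' j) * v (N' j)) =
        WittVector.teichmuller p (u ^ d) * c) (m : ℕ) :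
    c ∈ wittBall Fq p ‖u‖₊ hu1.le m := by
  classical
  have hu0' : 0 < ‖u‖₊ := nnnorm_pos.2 hu0
  -- Multiplication by `χ(u ^ (-d))` enlarges the `n`-th component by `‖u‖ ^ (-d * p ^ n)`.
  let r := ‖u‖₊ ^ (d * p ^ m + 1)
  have hr0 : 0 < r := pow_pos hu0' _
  have hr1 : r ≤ 1 := pow_le_one₀ zero_le hu1.le
  have hmul : ∀ x ∈ wittBall Fq p r hr1 m,
      WittVector.teichmuller p ((u ^ d)⁻¹) * x ∈ wittBall Fq p ‖u‖₊ hu1.le m := by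
    intro x hx n hn
    rw [WittVector.coeff_teichmuller_mul, norm_mul, norm_pow, norm_inv, norm_pow]
    have hpn : (‖u‖ ^ d) ^ p ^ m ≤ (‖u‖ ^ d) ^ p ^ n :=
      pow_le_pow_of_le_one (by positivity) (pow_le_one₀ (norm_nonneg _) hu1.le)
        (Nat.pow_le_pow_right (Fact.out : p.Prime).pos hn)
    have hpos : 0 < (‖u‖ ^ d) ^ p ^ n := by
      have := norm_pos_iff.2 hu0
      positivity
    rw [inv_pow, inv_mul_le_iff₀ hpos]
    refine (hx n hn).trans ?_
    simp only [r, NNReal.coe_pow, coe_nnnorm]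
    rw [pow_succ, pow_mul]
    exact mul_le_mul_of_nonneg_right hpn (norm_nonneg _)
  have htail : ∀ f, d < δ f → ‖v f‖ ≤ 1 → WittVector.teichmuller p ((u ^ d)⁻¹) *
      WittVector.teichmuller p (u ^ δ f * v f) ∈ wittBall Fq p ‖u‖₊ hu1.le m := by
    intro f hf hvf
    rw [← map_mul]
    refine teichmuller_mem_wittBall ?_
    obtain ⟨k, hk⟩ := Nat.exists_eq_add_of_lt hf
    have : (u ^ d)⁻¹ * (u ^ δ f * v f) = u * (u ^ k * v f) := by
      rw [hk]
      field_simp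
      ring
    rw [this, norm_mul, norm_mul, norm_pow]
    exact mul_le_of_le_one_right (norm_nonneg _)
      (mul_le_one₀ (pow_le_one₀ (norm_nonneg _) hu1.le) (norm_nonneg _) hvf)
  obtain ⟨s, hDs, hs⟩ := exists_finset_sum_sub_mem_wittBall ha D hr0 hr1 m
  obtain ⟨s', hDs', hs'⟩ := exists_finset_sum_sub_mem_wittBall ha' D' hr0 hr1 m
  have hmain := hmul _ (sub_mem hs hs')
  rw [sub_sub_sub_cancel_right, ← Finset.sum_sdiff hDs, ← Finset.sum_sdiff hDs',
    add_sub_add_comm, hc, mul_add, mul_sub, ← mul_assoc, ← map_mul,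
    inv_mul_cancel₀ (pow_ne_zero d hu0), map_one, one_mul, Finset.mul_sum, Finset.mul_sum] at hmain
  refine (AddSubgroup.add_mem_cancel_left _ (sub_mem ?_ ?_)).1 hmain
  · refine sum_mem fun i hi => htail _ ?_ (hv i)
    have := (Finset.mem_sdiff.1 hi).2
    rwa [hD, not_le] at this
  · refine sum_mem fun j hj => htail _ ?_ (hv' j)
    have := (Finset.mem_sdiff.1 hj).2
    rwa [hD', not_le] at this

/-- A lifted Dirichlet series determines its coefficients. -/
theorem card_fiber_eq_of_hasSum {ι κ : Type*} {N : ι → Fq[X]} {N' : κ → Fq[X]}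
    (hN : ∀ i, (N i).Monic) (hfin : ∀ d, {i | (N i).natDegree ≤ d}.Finite)
    (hN' : ∀ j, (N' j).Monic) (hfin' : ∀ d, {j | (N' j).natDegree ≤ d}.Finite)
    (h : ∀ u : CInfty Fq, u ≠ 0 → ‖u‖ < 1 → ∀ n : ℕ, ∃ a : W Fq p,
      HasSum (fun i => WittVector.teichmuller p (u ^ (N i).natDegree * oneUnitPart (N i) ^ n)) a ∧
      HasSum (fun j => WittVector.teichmuller p (u ^ (N' j).natDegree * oneUnitPart (N' j) ^ n)) a)
    (f : Fq[X]) (hf : f.Monic) :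
    Nat.card {i // N i = f} = Nat.card {j // N' j = f} := by
  classical
  induction hd : f.natDegree using Nat.strong_induction_on generalizing f with
  | _ d ih =>
    let b : Fq[X] → ℤ := fun g => (Nat.card {i // N i = g} : ℤ) - Nat.card {j // N' j = g}
    have hb : ∀ g, g.Monic → g.natDegree < d → b g = 0 := fun g hg hgd => by
      simp [b, ih _ hgd g hg rfl]
    let S := (finite_monic_natDegree_le Fq d).toFinset
    let T := S.filter fun g => g.natDegree = d
    have hS : ∀ g, g ∈ S ↔ g.Monic ∧ g.natDegree ≤ d := fun g => by simp [S]
    have hv : ∀ g : Fq[X], g.Monic → ∀ n, ‖oneUnitPart g ^ n‖ ≤ 1 := fun g hg n => by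
      rw [norm_pow, norm_eq_one_of_norm_sub_one_lt (norm_oneUnitPart_sub_one_lt hg), one_pow]
    have hzero : ∀ n : ℕ,
        ∑ g ∈ T, (b g : W Fq p) * WittVector.teichmuller p (oneUnitPart g) ^ n = 0 := by
      intro n
      refine eq_zero_of_forall_mem_wittBall fun u hu0 hu1 m => ?_
      obtain ⟨a, ha, ha'⟩ := h u hu0 hu1 n
      have hD : ∀ i, i ∈ (hfin d).toFinset ↔ (N i).natDegree ≤ d := fun i => by simp
      have hD' : ∀ j, j ∈ (hfin' d).toFinset ↔ (N' j).natDegree ≤ d := fun j => by simp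
      refine leading_difference_mem_wittBall (δ := natDegree) (v := fun g => oneUnitPart g ^ n)
        (fun i => hv _ (hN i) n) (fun j => hv _ (hN' j) n) hD hD' hu0 hu1 ha ha' ?_ m
      rw [sum_comp_eq_sum_card_nsmul N
          (fun g => WittVector.teichmuller p (u ^ g.natDegree * oneUnitPart g ^ n)) _ S
          (fun i => by rw [hD, hS, and_iff_right (hN i)]),
        sum_comp_eq_sum_card_nsmul N'
          (fun g => WittVector.teichmuller p (u ^ g.natDegree * oneUnitPart g ^ n)) _ S
          (fun j => by rw [hD', hS, and_iff_right (hN' j)]),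
        ← Finset.sum_sub_distrib, Finset.mul_sum, Finset.sum_filter]
      refine Finset.sum_congr rfl fun g hg => ?_
      obtain ⟨hgm, hgd⟩ := (hS g).1 hg
      have hbg : ∀ x : W Fq p, Nat.card {i // N i = g} • x - Nat.card {j // N' j = g} • x =
          (b g : W Fq p) * x := fun x => by
        simp only [b, nsmul_eq_mul]
        push_cast
        ring
      rw [hbg]
      split_ifs with hgd'
      · rw [hgd', map_mul, map_pow _ (oneUnitPart g)]
        ring
      · rw [hb g hgm (lt_of_le_of_ne hgd hgd'), Int.cast_zero, zero_mul]
    have hf0 := eq_zero_of_sum_teichmuller_pow_eq_zero T oneUnitPart (fun g hg g' hg' e =>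
      oneUnitPart_inj ((Finset.mem_filter.1 hg).2.trans (Finset.mem_filter.1 hg').2.symm) e) b hzero
      f (Finset.mem_filter.2 ⟨(hS f).2 ⟨hf, hd.le⟩, hd⟩)
    simpa [b, sub_eq_zero] using hf0

end GossZeta

/-! ### Norms of ideals and splitting types -/

namespace GossZeta

open UniqueFactorizationMonoid IsDedekindDomain

section

variable {F : Type*} [Field F]

theorem monic_monicGenerator {I : Ideal F[X]} (hI : I ≠ ⊥) : (monicGenerator I).Monic :=
  monic_mul_leadingCoeff_inv fun h => hI ((Submodule.IsPrincipal.eq_bot_iff_generator_eq_zero I).2 h)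

theorem span_monicGenerator (I : Ideal F[X]) : Ideal.span {monicGenerator I} = I := by
  rcases eq_or_ne I ⊥ with rfl | hI
  · simp [monicGenerator, Submodule.IsPrincipal.generator_bot]
  · have h0 : Submodule.IsPrincipal.generator I ≠ 0 :=
      fun h => hI ((Submodule.IsPrincipal.eq_bot_iff_generator_eq_zero I).2 h)
    rw [monicGenerator, Ideal.span_singleton_mul_right_unit, Ideal.span_singleton_generator]
    exact isUnit_C.2 (inv_ne_zero (leadingCoeff_ne_zero.2 h0)).isUnit

theorem irreducible_monicGenerator {𝔭 : Ideal F[X]} (h𝔭 : 𝔭.IsPrime) (h0 : 𝔭 ≠ ⊥) :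
    Irreducible (monicGenerator 𝔭) := by
  refine ((Ideal.span_singleton_prime (monic_monicGenerator h0).ne_zero).1 ?_).irreducible
  rwa [span_monicGenerator]

theorem monic_irreducible_pow_inj {f g : F[X]} (hf : Irreducible f) (hg : Irreducible g)
    (hfm : f.Monic) (hgm : g.Monic) {d e : ℕ} (hd : 0 < d) (h : f ^ d = g ^ e) : f = g ∧ d = e := by
  have hfg : f = g := by
    have hdvd : f ∣ g := hf.prime.dvd_of_dvd_pow (h ▸ dvd_pow_self f hd.ne')
    exact eq_of_monic_of_associated hfm hgm (hf.associated_of_dvd hg hdvd)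
  subst hfg
  have := congrArg natDegree h
  rw [natDegree_pow, natDegree_pow] at this
  exact ⟨rfl, Nat.eq_of_mul_eq_mul_right hf.natDegree_pos this⟩

end

variable {Fq : Type*} [Field Fq] {K : Type*} [Field K] [Algebra Fq[X] K] [Algebra (RatFunc Fq) K]
  [IsScalarTower Fq[X] (RatFunc Fq) K] [FunctionField Fq K] [Algebra.IsSeparable (RatFunc Fq) K]

/-- The norm of a nonzero prime of `𝓞_K`. -/
def primeNorm (P : HeightOneSpectrum (OK Fq K)) : Fq[X] :=
  monicGenerator (P.asIdeal.under Fq[X]) ^ P.asIdeal.inertiaDeg Fq[X]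

theorem under_ne_bot (P : HeightOneSpectrum (OK Fq K)) : P.asIdeal.under Fq[X] ≠ ⊥ :=
  Ideal.IsIntegral.comap_ne_bot Fq[X] P.ne_bot

theorem inertiaDeg_pos (P : Ideal (OK Fq K)) [P.IsPrime] : 0 < P.inertiaDeg Fq[X] :=
  Ideal.inertiaDeg_pos P Fq[X]

theorem monic_primeNorm (P : HeightOneSpectrum (OK Fq K)) : (primeNorm P).Monic :=
  (monic_monicGenerator (under_ne_bot P)).pow _

theorem irreducible_monicGenerator_under (P : HeightOneSpectrum (OK Fq K)) :
    Irreducible (monicGenerator (P.asIdeal.under Fq[X])) :=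
  have := P.isPrime
  irreducible_monicGenerator inferInstance (under_ne_bot P)

theorem natDegree_monicGenerator_under_le (P : HeightOneSpectrum (OK Fq K)) :
    (monicGenerator (P.asIdeal.under Fq[X])).natDegree ≤ (primeNorm P).natDegree := by
  have := P.isPrime
  rw [primeNorm, natDegree_pow]
  exact Nat.le_mul_of_pos_left _ (inertiaDeg_pos P.asIdeal)

theorem natDegree_primeNorm_pos (P : HeightOneSpectrum (OK Fq K)) : 0 < (primeNorm P).natDegree :=
  (irreducible_monicGenerator_under P).natDegree_pos.trans_le (natDegree_monicGenerator_under_le P)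

theorem finite_natDegree_primeNorm_le [Finite Fq] (d : ℕ) :
    {P : HeightOneSpectrum (OK Fq K) | (primeNorm P).natDegree ≤ d}.Finite := by
  refine ((finite_monic_natDegree_le Fq d).biUnion fun g _ =>
    (finite_primesOver K (Ideal.span {g})).preimage
      (f := fun P : HeightOneSpectrum (OK Fq K) => P.asIdeal)
      (fun P _ Q _ h => HeightOneSpectrum.ext h)).subset fun P hP => ?_
  refine Set.mem_biUnion (x := monicGenerator (P.asIdeal.under Fq[X]))
    ⟨monic_monicGenerator (under_ne_bot P), (natDegree_monicGenerator_under_le P).trans hP⟩ ?_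
  exact ⟨P.isPrime, ⟨span_monicGenerator _⟩⟩

theorem finite_primeNorm_eq [Finite Fq] (g : Fq[X]) :
    Finite {P : HeightOneSpectrum (OK Fq K) // primeNorm P = g} :=
  Set.Finite.to_subtype (s := {P | primeNorm P = g})
    ((finite_natDegree_primeNorm_le g.natDegree).subset fun _ hP => (congrArg natDegree hP).le)

/-- The product of a multiset of nonzero primes, as a nonzero ideal. -/
def idealOfMultiset (s : Multiset (HeightOneSpectrum (OK Fq K))) :
    {I : Ideal (OK Fq K) // I ≠ ⊥} :=
  ⟨(s.map fun P => P.asIdeal).prod, Multiset.prod_ne_zero fun h => by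
    obtain ⟨P, -, hP⟩ := Multiset.mem_map.1 h
    exact P.ne_bot hP⟩

theorem normalizedFactors_idealOfMultiset (s : Multiset (HeightOneSpectrum (OK Fq K))) :
    normalizedFactors (idealOfMultiset s).1 = s.map fun P => P.asIdeal :=
  normalizedFactors_prod_of_prime fun I hI => by
    obtain ⟨P, -, rfl⟩ := Multiset.mem_map.1 hI
    exact P.prime

theorem idealNorm_idealOfMultiset (s : Multiset (HeightOneSpectrum (OK Fq K))) :
    idealNorm Fq (idealOfMultiset s).1 = (s.map primeNorm).prod := by
  rw [idealNorm, normalizedFactors_idealOfMultiset, Multiset.map_map]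
  rfl

/-- Unique factorization of ideals. -/
theorem bijective_idealOfMultiset :
    Function.Bijective (idealOfMultiset : Multiset (HeightOneSpectrum (OK Fq K)) → _) := by
  constructor
  · intro s t h
    have := congrArg (fun I => normalizedFactors I.1) h
    simp only [normalizedFactors_idealOfMultiset] at this
    exact Multiset.map_injective (fun P Q h => HeightOneSpectrum.ext h) this
  · rintro ⟨I, hI⟩
    have hprime : ∀ P ∈ normalizedFactors I, Prime P := fun P hP => prime_of_normalized_factor P hP
    refine ⟨(normalizedFactors I).attach.map fun P =>
      ⟨P.1, Ideal.isPrime_of_prime (hprime P.1 P.2), (hprime P.1 P.2).ne_zero⟩, Subtype.ext ?_⟩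
    refine (congrArg Multiset.prod (Multiset.map_map _ _ _)).trans ?_
    refine (congrArg Multiset.prod (Multiset.attach_map_val _)).trans ?_
    exact associated_iff_eq.1 (prod_normalizedFactors hI)

theorem monic_idealNorm (I : {I : Ideal (OK Fq K) // I ≠ ⊥}) : (idealNorm Fq I.1).Monic := by
  obtain ⟨s, rfl⟩ := bijective_idealOfMultiset.2 I
  rw [idealNorm_idealOfMultiset]
  exact monic_prod_map monic_primeNorm s

theorem finite_natDegree_idealNorm_le [Finite Fq] (d : ℕ) :
    {I : {I : Ideal (OK Fq K) // I ≠ ⊥} | (idealNorm Fq I.1).natDegree ≤ d}.Finite := by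
  refine ((finite_natDegree_prod_map_le (N := primeNorm (Fq := Fq) (K := K)) monic_primeNorm
    natDegree_primeNorm_pos finite_natDegree_primeNorm_le d).image idealOfMultiset).subset
      fun I hI => ?_
  obtain ⟨s, rfl⟩ := bijective_idealOfMultiset.2 I
  refine ⟨s, ?_, rfl⟩
  rwa [Set.mem_ofPred_eq, idealNorm_idealOfMultiset] at hI

theorem finite_idealNorm_eq [Finite Fq] (g : Fq[X]) :
    Finite {I : {I : Ideal (OK Fq K) // I ≠ ⊥} // idealNorm Fq I.1 = g} :=
  Set.Finite.to_subtype (s := {I : {I : Ideal (OK Fq K) // I ≠ ⊥} | idealNorm Fq I.1 = g})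
    ((finite_natDegree_idealNorm_le g.natDegree).subset fun _ hI => (congrArg natDegree hI).le)

theorem idealCount_eq_card_fiber (f : Fq[X]) :
    idealCount Fq K f = Nat.card {I : {I : Ideal (OK Fq K) // I ≠ ⊥} // idealNorm Fq I.1 = f} :=
  Nat.card_congr (Equiv.subtypeSubtypeEquivSubtypeInter _ _).symm

theorem idealCount_eq_card_multiset (f : Fq[X]) :
    idealCount Fq K f =
      Nat.card {s : Multiset (HeightOneSpectrum (OK Fq K)) // (s.map primeNorm).prod = f} := by
  rw [idealCount_eq_card_fiber]
  exact (card_fiber_eq_of_equiv (Equiv.ofBijective _ bijective_idealOfMultiset)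
    idealNorm_idealOfMultiset f).symm

/-- The norm of a prime determines the prime below it and its inertia degree. -/
theorem primeNorm_eq_iff {𝔭 : Ideal Fq[X]} (h𝔭 : 𝔭.IsPrime) (h0 : 𝔭 ≠ ⊥)
    (d : ℕ) (P : HeightOneSpectrum (OK Fq K)) :
    primeNorm P = monicGenerator 𝔭 ^ d ↔
      P.asIdeal ∈ 𝔭.primesOver (OK Fq K) ∧ P.asIdeal.inertiaDeg Fq[X] = d := by
  have := P.isPrime
  constructor
  · intro h
    obtain ⟨h1, h2⟩ := monic_irreducible_pow_inj (irreducible_monicGenerator_under P)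
      (irreducible_monicGenerator h𝔭 h0) (monic_monicGenerator (under_ne_bot P))
      (monic_monicGenerator h0) (inertiaDeg_pos P.asIdeal) h
    refine ⟨⟨P.isPrime, ⟨?_⟩⟩, h2⟩
    rw [← span_monicGenerator 𝔭, ← h1, span_monicGenerator]
  · rintro ⟨⟨-, ⟨h1⟩⟩, h2⟩
    rw [primeNorm, ← h1, h2]

theorem card_primeNorm_eq_count {𝔭 : Ideal Fq[X]} (h𝔭 : 𝔭.IsPrime) (h0 : 𝔭 ≠ ⊥) (d : ℕ) :
    Nat.card {P : HeightOneSpectrum (OK Fq K) // primeNorm P = monicGenerator 𝔭 ^ d} =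
      (splittingType K 𝔭).count d := by
  classical
  rw [← Multiset.coe_count, splittingType, Multiset.sort_eq, Multiset.count_map]
  have h : Nat.card {P : HeightOneSpectrum (OK Fq K) // primeNorm P = monicGenerator 𝔭 ^ d} =
      Nat.card ((finite_primesOver K 𝔭).toFinset.filter fun P => d = P.inertiaDeg Fq[X]) := by
    refine Nat.card_congr ⟨fun P => ⟨P.1.asIdeal, ?_⟩, fun P => ⟨⟨P.1, ?_, ?_⟩, ?_⟩,
      fun _ => rfl, fun _ => rfl⟩
    · have := (primeNorm_eq_iff h𝔭 h0 d P.1).1 P.2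
      rw [Finset.mem_filter, Set.Finite.mem_toFinset]
      exact ⟨this.1, this.2.symm⟩
    · have := (Finset.mem_filter.1 P.2).1
      rw [Set.Finite.mem_toFinset] at this
      exact this.1
    · have := (Finset.mem_filter.1 P.2).1
      rw [Set.Finite.mem_toFinset] at this
      have := this.2
      have : FaithfulSMul Fq[X] (OK Fq K) := (faithfulSMul_iff_algebraMap_injective _ _).2
        (FunctionField.ringOfIntegers.algebraMap_injective Fq K)
      exact Ideal.ne_bot_of_liesOver_of_ne_bot h0 P.1
    · have := Finset.mem_filter.1 P.2
      rw [Set.Finite.mem_toFinset] at this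
      exact (primeNorm_eq_iff h𝔭 h0 d _).2 ⟨this.1, this.2.symm⟩
  rw [h, Nat.card_eq_finsetCard]
  rfl

variable {L : Type*} [Field L] [Algebra Fq[X] L] [Algebra (RatFunc Fq) L]
  [IsScalarTower Fq[X] (RatFunc Fq) L] [FunctionField Fq L] [Algebra.IsSeparable (RatFunc Fq) L]

theorem arithEquivNoExceptions_iff_card_primeNorm :
    ArithEquivNoExceptions Fq K L ↔ ∀ g : Fq[X],
      Nat.card {P : HeightOneSpectrum (OK Fq K) // primeNorm P = g} =
        Nat.card {P : HeightOneSpectrum (OK Fq L) // primeNorm P = g} := by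
  constructor
  · intro h g
    by_cases hg : ∃ (𝔭 : Ideal Fq[X]) (d : ℕ), 𝔭.IsPrime ∧ 𝔭 ≠ ⊥ ∧ g = monicGenerator 𝔭 ^ d
    · obtain ⟨𝔭, d, h𝔭, h0, rfl⟩ := hg
      rw [card_primeNorm_eq_count h𝔭 h0, card_primeNorm_eq_count h𝔭 h0, h 𝔭 h𝔭 h0]
    · have hK : IsEmpty {P : HeightOneSpectrum (OK Fq K) // primeNorm P = g} := ⟨fun P => hg
        ⟨_, _, have := P.1.isPrime; inferInstance, under_ne_bot P.1, P.2.symm⟩⟩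
      have hL : IsEmpty {P : HeightOneSpectrum (OK Fq L) // primeNorm P = g} := ⟨fun P => hg
        ⟨_, _, have := P.1.isPrime; inferInstance, under_ne_bot P.1, P.2.symm⟩⟩
      rw [Nat.card_of_isEmpty, Nat.card_of_isEmpty]
  · intro h 𝔭 h𝔭 h0
    refine List.Perm.eq_of_pairwise' (Multiset.pairwise_sort _ _) (Multiset.pairwise_sort _ _)
      (List.perm_iff_count.2 fun d => ?_)
    have := h (monicGenerator 𝔭 ^ d)
    rwa [card_primeNorm_eq_count h𝔭 h0, card_primeNorm_eq_count h𝔭 h0] at this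

theorem arithEquivNoExceptions_iff_idealCount [Finite Fq] :
    ArithEquivNoExceptions Fq K L ↔
      ∀ f : Fq[X], f.Monic → idealCount Fq K f = idealCount Fq L f := by
  rw [arithEquivNoExceptions_iff_card_primeNorm]
  constructor
  · intro h f _
    obtain ⟨e, he⟩ := exists_equiv_of_card_fiber_eq finite_primeNorm_eq finite_primeNorm_eq h
    rw [idealCount_eq_card_multiset, idealCount_eq_card_multiset]
    exact card_multiset_prod_eq_of_equiv e he f
  · intro h
    refine card_fiber_eq_of_card_prod_map_eq monic_primeNorm natDegree_primeNorm_pos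
      finite_natDegree_primeNorm_le monic_primeNorm natDegree_primeNorm_pos
      finite_natDegree_primeNorm_le fun g hg => ?_
    rw [← idealCount_eq_card_multiset, ← idealCount_eq_card_multiset, h g hg]

/-! ### The lifted Goss zeta function -/

section Zeta

variable [Finite Fq] {p : ℕ} [Fact p.Prime]

theorem base_neg (s : SInfty Fq p) : (-s).base = s.base⁻¹ := by
  simp [SInfty.base]

variable [CharP Fq p]

theorem norm_gossPow_neg {f : Fq[X]} (hf : f.Monic) (s : SInfty Fq p) :
    ‖gossPow f (-s)‖ = ‖s.base‖⁻¹ ^ f.natDegree := by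
  rw [gossPow, norm_mul, norm_oneUnitPow (norm_oneUnitPart_sub_one_lt hf), mul_one, norm_pow,
    base_neg, norm_inv]

theorem summable_zetaTerm {s : SInfty Fq p} (hs : s ∈ halfPlane Fq p) :
    Summable (zetaTerm Fq K s) := by
  have hs' : 1 < ‖s.base‖ := hs
  have hlt : ‖s.base‖⁻¹ < 1 := inv_lt_one_of_one_lt₀ hs'
  refine summable_teichmuller (fun I => ?_) fun r hr => ?_
  · rw [norm_gossPow_neg (monic_idealNorm I)]
    exact pow_le_one₀ (by positivity) hlt.le
  · obtain ⟨d, hd⟩ := exists_pow_lt_of_lt_one (NNReal.coe_pos.2 hr) hlt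
    refine (finite_natDegree_idealNorm_le (K := K) d).subset fun I hI => ?_
    rw [Set.mem_ofPred_eq, norm_gossPow_neg (monic_idealNorm I)] at hI
    by_contra hdeg
    exact absurd (hd.trans hI)
      (pow_le_pow_of_le_one (by positivity) hlt.le (le_of_not_ge hdeg)).not_gt

/-- The term of the lifted Goss zeta function at `s = (u⁻¹, -n)`. -/
theorem zetaTerm_inv_neg_natCast (u : (CInfty Fq)ˣ) (n : ℕ) (I : {I : Ideal (OK Fq K) // I ≠ ⊥}) :
    zetaTerm Fq K ((Additive.ofMul u⁻¹, -(n : ℤ_[p])) : SInfty Fq p) I =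
      WittVector.teichmuller p
        ((u : CInfty Fq) ^ (idealNorm Fq I.1).natDegree * oneUnitPart (idealNorm Fq I.1) ^ n) := by
  rw [zetaTerm, gossPow, Prod.snd_neg, neg_neg, oneUnitPow_natCast, base_neg]
  simp [SInfty.base]

theorem eqOn_liftedGossZeta_iff_idealCount :
    Set.EqOn (liftedGossZeta Fq K) (liftedGossZeta Fq L) (halfPlane Fq p) ↔
      ∀ f : Fq[X], f.Monic → idealCount Fq K f = idealCount Fq L f := by
  constructor
  · intro h f hf
    rw [idealCount_eq_card_fiber, idealCount_eq_card_fiber]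
    refine card_fiber_eq_of_hasSum (p := p) monic_idealNorm finite_natDegree_idealNorm_le
      monic_idealNorm finite_natDegree_idealNorm_le (fun u hu0 hu1 n => ?_) f hf
    let s : SInfty Fq p := (Additive.ofMul (Units.mk0 u hu0)⁻¹, -(n : ℤ_[p]))
    have hs : s ∈ halfPlane Fq p := by
      have : s.base = u⁻¹ := by simp [s, SInfty.base]
      rw [halfPlane, Set.mem_ofPred_eq, this, norm_inv]
      exact (one_lt_inv₀ (norm_pos_iff.2 hu0)).2 hu1
    have hK := (summable_zetaTerm (K := K) hs).hasSum
    have hL := (summable_zetaTerm (K := L) hs).hasSum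
    have hKL : ∑' I, zetaTerm Fq K s I = ∑' I, zetaTerm Fq L s I := h hs
    rw [← hKL] at hL
    exact ⟨_, hK.congr_fun fun I => (zetaTerm_inv_neg_natCast (Units.mk0 u hu0) n I).symm,
      hL.congr_fun fun I => (zetaTerm_inv_neg_natCast (Units.mk0 u hu0) n I).symm⟩
  · intro h s _
    have hfib : ∀ f : Fq[X], Nat.card {I : {I : Ideal (OK Fq K) // I ≠ ⊥} // idealNorm Fq I.1 = f} =
        Nat.card {I : {I : Ideal (OK Fq L) // I ≠ ⊥} // idealNorm Fq I.1 = f} := by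
      intro f
      by_cases hf : f.Monic
      · rw [← idealCount_eq_card_fiber, ← idealCount_eq_card_fiber, h f hf]
      · have hK : IsEmpty {I : {I : Ideal (OK Fq K) // I ≠ ⊥} // idealNorm Fq I.1 = f} :=
          ⟨fun I => hf (I.2 ▸ monic_idealNorm I.1)⟩
        have hL : IsEmpty {I : {I : Ideal (OK Fq L) // I ≠ ⊥} // idealNorm Fq I.1 = f} :=
          ⟨fun I => hf (I.2 ▸ monic_idealNorm I.1)⟩
        rw [Nat.card_of_isEmpty, Nat.card_of_isEmpty]
    obtain ⟨e, he⟩ := exists_equiv_of_card_fiber_eq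
      (f := fun I : {I : Ideal (OK Fq K) // I ≠ ⊥} => idealNorm Fq I.1)
      (g := fun I : {I : Ideal (OK Fq L) // I ≠ ⊥} => idealNorm Fq I.1)
      finite_idealNorm_eq finite_idealNorm_eq hfib
    rw [liftedGossZeta, liftedGossZeta, ← e.tsum_eq]
    refine tsum_congr fun I => ?_
    rw [zetaTerm, zetaTerm, he]

end Zeta

end GossZeta

end

theorem mainTheorem2
    (p : ℕ) [Fact p.Prime] (Fq : Type*) [Field Fq] [Finite Fq] [CharP Fq p]
    (K : Type*) [Field K] [Algebra Fq[X] K] [Algebra (RatFunc Fq) K]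
    [IsScalarTower Fq[X] (RatFunc Fq) K] [FiniteDimensional (RatFunc Fq) K]
    [Algebra.IsSeparable (RatFunc Fq) K]
    (L : Type*) [Field L] [Algebra Fq[X] L] [Algebra (RatFunc Fq) L]
    [IsScalarTower Fq[X] (RatFunc Fq) L] [FiniteDimensional (RatFunc Fq) L]
    [Algebra.IsSeparable (RatFunc Fq) L] :
    (∀ s ∈ GossZeta.halfPlane Fq p,
      Summable (GossZeta.zetaTerm Fq K s) ∧ Summable (GossZeta.zetaTerm Fq L s)) ∧
    (GossZeta.ArithEquivNoExceptions Fq K L ↔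
      Set.EqOn (GossZeta.liftedGossZeta Fq K) (GossZeta.liftedGossZeta Fq L)
        (GossZeta.halfPlane Fq p)) ∧
    (Set.EqOn (GossZeta.liftedGossZeta Fq K) (GossZeta.liftedGossZeta Fq L)
        (GossZeta.halfPlane Fq p) ↔
      ∀ f : Fq[X], f.Monic → GossZeta.idealCount Fq K f = GossZeta.idealCount Fq L f) := by
  exact ⟨fun s hs => ⟨GossZeta.summable_zetaTerm hs, GossZeta.summable_zetaTerm hs⟩,
    GossZeta.arithEquivNoExceptions_iff_idealCount.trans
      GossZeta.eqOn_liftedGossZeta_iff_idealCount.symm,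
    GossZeta.eqOn_liftedGossZeta_iff_idealCount⟩
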